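/- Let $[n]_q=\frac{q^n-q^{-n}}{q-q^{-1}}$ for integers $n\geqslant 0$. For a partition $\mu$ and an integer $h\geqslant 0$ let $s_\mu[s_h](q,q^{-1})$ be the plethysm of the Schur polynomials $s_\mu$ and $s_h=s_{(h)}$ evaluated at the two variables $q,q^{-1}$; here $s_\mu[s_\nu](x_1,\dots,x_n)=s_\mu(m_1,\dots,m_N)$ if $s_\nu(x_1,\dots,x_n)=m_1+\cdots+m_N$ is the expansion of $s_\nu(x_1,\dots,x_n)$ into monomials (with repetitions) given by the semistandard Young tableaux of shape $\nu$. For every partition $\mu$ (the empty partition included) there is a unique family of integers $a_{\mu[h]}^{[k]}$ ($h,k\geqslant 0$), with $a_{\mu[h]}^{[0]}=0$ for all $h$ and, for every fixed $h$, $a_{\mu[h]}^{[k]}=0$ for all but finitely many $k$, such that \[ s_\mu[s_h](q,q^{-1})=\sum_{k\geqslant 1}a_{\mu[h]}^{[k]}\,[k]_q\qquad\text{for all }h\geqslant 0. \] These are the $\mathrm{SL}_2$-plethysm coefficients. Their generating function \[ A_\mu(z,q)=\sum_{h\geqslant 0,\;k\geqslant 1}a_{\mu[h]}^{[k]}\,q^kz^h,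 \] a formal power series in $z$ and $q$, is an Elliott-rational function: it is equal to a rational function over $\mathbb{Q}$ that can be written as a quotient $P/D$ in which $P$ is a polynomial and $D\neq 0$ is a finite product of factors, each of which is the difference of two monomials (with coefficient $1$), where either monomial may be replaced by $0$. In particular $A_\mu(z,q)$ is rational, and the $\mathrm{SL}_2$-plethysm coefficients satisfy a linear recurrence with constant coefficients: there are rational numbers $c_{i,j}$, indexed by $(i,j)\in\mathbb{Z}_{\geqslant 0}^2\setminus\{(0,0)\}$ and only finitely many of them nonzero, such that \[ a_{\mu[h]}^{[k]}=\sum_{(i,j)\neq(0,0)}c_{i,j}\,a_{\mu[h-i]}^{[k-j]} \] for all but finitely many pairs $(h,k)\in\mathbb{Z}_{\geqslant 0}^2$, where terms with $h-i<0$ or $k-j<0$ are read as $0$. -/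

import Mathlib

open scoped LaurentPolynomial

noncomputable section

namespace SL2Plethysm

/-- Semistandard Young tableaux of shape `μ` over the alphabet `{0, …, N - 1}`. -/
def SSYT (N : ℕ) (μ : YoungDiagram) : Type :=
  {T : SemistandardYoungTableau μ // ∀ c : μ.cells, T c.1.1 c.1.2 < N}

namespace SSYT

variable {N : ℕ} {μ : YoungDiagram}

/-- The entry of a tableau in a cell, as a letter of the alphabet `{0, …, N - 1}`. -/
def letter (T : SSYT N μ) (c : μ.cells) : Fin N :=
  ⟨T.1 c.1.1 c.1.2, T.2 c⟩

theorem letter_injective : Function.Injective (letter : SSYT N μ → μ.cells → Fin N) := by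
  intro S T h
  apply Subtype.ext
  apply SemistandardYoungTableau.ext
  intro i j
  by_cases hc : (i, j) ∈ μ
  · have h1 := congrFun h ⟨(i, j), hc⟩
    exact congrArg Fin.val h1
  · rw [S.1.zeros hc, T.1.zeros hc]

instance : Finite (SSYT N μ) := Finite.of_injective _ letter_injective

instance : Fintype (SSYT N μ) := Fintype.ofFinite _

/-- The monomial `x ^ wt(T)`, the product of the variables `x_i` over all entries `i` of `T`. -/
def weightMonomial (T : SSYT N μ) : MvPolynomial (Fin N) ℤ :=
  ∏ c : μ.cells, MvPolynomial.X (T.letter c)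

end SSYT

/-- The Schur polynomial `s_μ(x_0, …, x_{N-1})`. -/
def schurPoly (N : ℕ) (μ : YoungDiagram) : MvPolynomial (Fin N) ℤ :=
  ∑ T : SSYT N μ, T.weightMonomial

/-- The plethysm `s_μ[s_ν](x_0, …, x_{n-1})`: if `s_ν(x_0, …, x_{n-1})` is the sum of the monomials
`m_0, …, m_{N-1}` (one for each tableau of shape `ν`, that is, the weights with multiplicity of the
representation with character `s_ν`), then `s_μ[s_ν] = s_μ(m_0, …, m_{N-1})`. The enumeration
of the monomials is immaterial because Schur polynomials are symmetric. -/
def plethysm (n : ℕ) (μ ν : YoungDiagram) : MvPolynomial (Fin n) ℤ :=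
  MvPolynomial.aeval
    (fun i : Fin (Fintype.card (SSYT n ν)) =>
      ((Fintype.equivFin (SSYT n ν)).symm i).weightMonomial)
    (schurPoly (Fintype.card (SSYT n ν)) μ)

/-- The one-row partition `(h)` (the empty partition if `h = 0`). -/
def oneRow (h : ℕ) : YoungDiagram :=
  YoungDiagram.ofRowLens [h] (by simp [List.SortedGE, antitone_iff_forall_lt])

/-- The `SL₂`-character `s_μ[s_h](q, q⁻¹)`, a Laurent polynomial in `q`. -/
def sl2Plethysm (μ : YoungDiagram) (h : ℕ) : ℤ[T;T⁻¹] :=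
  MvPolynomial.aeval ![LaurentPolynomial.T 1, LaurentPolynomial.T (-1)] (plethysm 2 μ (oneRow h))

/-- The `q`-integer `[n]_q = (q^n - q^{-n}) / (q - q^{-1}) = q^{n-1} + q^{n-3} + ⋯ + q^{1-n}`. -/
def qInt (n : ℕ) : ℤ[T;T⁻¹] :=
  ∑ i ∈ Finset.range n, LaurentPolynomial.T ((n : ℤ) - 1 - 2 * i)

theorem qInt_mul (n : ℕ) :
    qInt n * (LaurentPolynomial.T 1 - LaurentPolynomial.T (-1)) =
      LaurentPolynomial.T (n : ℤ) - LaurentPolynomial.T (-(n : ℤ)) := by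
  have h := Finset.sum_range_sub'
    (fun i : ℕ => (LaurentPolynomial.T ((n : ℤ) - 2 * i) : ℤ[T;T⁻¹])) n
  rw [qInt, Finset.sum_mul]
  refine Eq.trans (Finset.sum_congr rfl fun i _ => ?_) (h.trans ?_)
  · rw [mul_sub, ← LaurentPolynomial.T_add, ← LaurentPolynomial.T_add]
    push_cast
    congr 2 <;> ring
  · push_cast
    congr 2; ring

/-- `a h k` is the `SL₂`-plethysm coefficient `a_{μ[h]}^{[k]}`: the coefficient of `[k]_q` in the
expansion of `s_μ[s_h](q, q⁻¹)` into `q`-integers, with the convention `a_{μ[h]}^{[0]} = 0`. -/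
def IsPlethysmCoeff (μ : YoungDiagram) (a : ℕ → ℕ →₀ ℤ) : Prop :=
  ∀ h : ℕ, a h 0 = 0 ∧ sl2Plethysm μ h = (a h).sum fun k c => c • qInt k

/-- The formal power series `∑_{h ≥ 0, k ≥ 1} a h k * z ^ h * q ^ k`, where `z` is the variable
with index `0` and `q` is the variable with index `1`. -/
def genSeries (a : ℕ → ℕ →₀ ℤ) : MvPowerSeries (Fin 2) ℚ :=
  fun m => if 1 ≤ m 1 then (a (m 0) (m 1) : ℚ) else 0

/-- A polynomial that is a monomial (with coefficient one) or zero. -/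
def IsMonomialOrZero {σ : Type*} (p : MvPolynomial σ ℚ) : Prop :=
  p = 0 ∨ ∃ s : σ →₀ ℕ, p = MvPolynomial.monomial s 1

/-- A rational function is Elliott-rational if it can be written with a denominator that is a
product of (nonzero) factors, each of which is one monomial minus another, the zero monomial being
allowed. Monomials with negative exponents give nothing new, since they can be cleared into the
numerator and into denominator factors of the form `m - 0`. -/
def IsElliottRational {σ : Type*} (f : FractionRing (MvPolynomial σ ℚ)) : Prop :=
  ∃ (p : MvPolynomial σ ℚ) (S : Multiset (MvPolynomial σ ℚ)),
    (∀ d ∈ S, d ≠ 0 ∧ ∃ m m' : MvPolynomial σ ℚ,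
      IsMonomialOrZero m ∧ IsMonomialOrZero m' ∧ d = m - m') ∧
    f = algebraMap _ (FractionRing (MvPolynomial σ ℚ)) p / algebraMap _ _ S.prod

/-- The formal power series `F` is equal to the rational function `f`. -/
def IsExpansion {σ : Type*} (F : MvPowerSeries σ ℚ) (f : FractionRing (MvPolynomial σ ℚ)) :
    Prop :=
  ∃ p d : MvPolynomial σ ℚ, d ≠ 0 ∧
    f = algebraMap _ (FractionRing (MvPolynomial σ ℚ)) p / algebraMap _ _ d ∧
    (d : MvPowerSeries σ ℚ) * F = (p : MvPowerSeries σ ℚ)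

/-- The array `u` satisfies a linear recurrence with constant coefficients: for all but finitely
many `(h, k)`, `u h k` is a fixed finite linear combination of the earlier entries
`u (h - i) (k - j)` with `(i, j) ≠ (0, 0)`, where entries with a negative index are zero. -/
def SatisfiesLinearRecurrence (u : ℕ → ℕ → ℚ) : Prop :=
  ∃ c : ℕ × ℕ →₀ ℚ, c (0, 0) = 0 ∧
    {x : ℕ × ℕ | u x.1 x.2 ≠ c.sum fun s r =>
      r * if s.1 ≤ x.1 ∧ s.2 ≤ x.2 then u (x.1 - s.1) (x.2 - s.2) else 0}.Finite

end SL2Plethysm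

end

/-!
By the branching rule, the Schur polynomial of `ν` at a list `x :: xs` is the sum over the
diagrams `λ` for which `ν / λ` is a horizontal strip of the Schur polynomial of `λ` at `xs` times
`x ^ (|ν| - |λ|)`. In this form (`schurSum`) symmetry in the variables is transparent: exchanging
two neighbouring variables amounts to reflecting, for `κ ⊆ λ ⊆ ν`, every row length `λ_i` in the
interval allowed by `κ` and `ν` (`benderKnuth`, `schurSum_perm`). Hence `s_μ[s_h](q, q⁻¹)` is the
Schur polynomial of `μ` at `q^h, q^{h-2}, …, q^{-h}`, in any order (`sl2Plethysm_eq_schurSum`),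
and it is invariant under `q ↦ q⁻¹` (`invert_sl2Plethysm`).

A Laurent polynomial `p` that is invariant under `q ↦ q⁻¹` is a combination of `q`-integers in
exactly one way, and the coefficient of `[k]_q` is the coefficient of `q^k` in `(q - q⁻¹) p`,
because `(q - q⁻¹) [k]_q = q^k - q^{-k}`. Therefore `A_μ(z, q)` is the part with positive
exponents of `q` of `(q - q⁻¹) ∑ s_μ[s_h](q, q⁻¹) z^h`.

The series `∑ s_μ[s_h](q, q⁻¹) z^h` is rational: after a normalization by powers of `q`, the
branching rule becomes a recursion in `h` with constant coefficients that is triangular with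
respect to inclusion of diagrams, so that the denominator is a product of factors `1 - z q^e`
(`transfer_succ`, `hasDen_transfer`). It remains to see that the part with positive exponents of
`q` of such a series is again Elliott-rational (`HasDen.positivePart`). Every factor `1 - z q^e`
divides a factor in which the exponent of `q` is `0` or `± L`, for one common `L`. If `A` and `B`
are monomials with the exponents `L` and `-L` of `q`, then `1 - A B` is free of `q` and `1 - A B =
(1 - A) + (1 - B) - (1 - A) (1 - B)`, which reduces the number of factors that involve `q`. When
all of these have the same sign, either the positive or the nonpositive part of the series is a
Laurent polynomial. The linear recurrence is the denominator, read off coefficientwise.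
-/

noncomputable section

namespace SL2Plethysm

/-! ### Horizontal strips -/

/-- `ν / λ` is a horizontal strip: `λ ⊆ ν`, and no two cells of `ν` outside `λ` lie in the same
column. -/
def IsStrip (lam ν : YoungDiagram) : Prop :=
  lam ≤ ν ∧ ∀ i j, (i + 1, j) ∈ ν → (i, j) ∈ lam

theorem finite_setOf_isStrip (ν : YoungDiagram) : {lam | IsStrip lam ν}.Finite := by
  refine Set.Finite.of_finite_image (f := YoungDiagram.cells)
    ((Finset.finite_toSet ν.cells.powerset).subset ?_) fun a _ b _ h => YoungDiagram.ext h
  rintro _ ⟨lam, h, rfl⟩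
  simpa using YoungDiagram.cells_subset_iff.2 h.1

/-- The diagrams obtained from `ν` by removing a horizontal strip. -/
def strips (ν : YoungDiagram) : Finset YoungDiagram :=
  (finite_setOf_isStrip ν).toFinset

@[simp]
theorem mem_strips {lam ν : YoungDiagram} : lam ∈ strips ν ↔ IsStrip lam ν := by
  simp [strips]

theorem le_iff_rowLen_le {lam ν : YoungDiagram} : lam ≤ ν ↔ ∀ i, lam.rowLen i ≤ ν.rowLen i := by
  constructor
  · intro h i
    by_contra! hlt
    exact absurd (h (YoungDiagram.mem_iff_lt_rowLen.2 hlt))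
      (by simp [YoungDiagram.mem_iff_lt_rowLen])
  · rintro h ⟨i, j⟩ hc
    exact YoungDiagram.mem_iff_lt_rowLen.2 ((YoungDiagram.mem_iff_lt_rowLen.1 hc).trans_le (h i))

/-- Horizontal strips are interlacing pairs of row lengths. -/
theorem isStrip_iff_rowLen {lam ν : YoungDiagram} :
    IsStrip lam ν ↔ ∀ i, lam.rowLen i ≤ ν.rowLen i ∧ ν.rowLen (i + 1) ≤ lam.rowLen i := by
  rw [IsStrip, le_iff_rowLen_le, forall_and]
  refine and_congr_right fun _ => forall_congr' fun i => ?_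
  simp only [YoungDiagram.mem_iff_lt_rowLen]
  exact ⟨fun h => by by_contra! hlt; exact lt_irrefl _ (h _ hlt), fun h j hj => hj.trans_le h⟩

theorem card_eq_sum_rowLen {lam : YoungDiagram} {K : ℕ} (h : lam.rowLen K = 0) :
    lam.card = ∑ i ∈ Finset.range K, lam.rowLen i := by
  rw [YoungDiagram.card, Finset.card_eq_sum_card_fiberwise (f := Prod.fst) (t := Finset.range K)]
  · refine Finset.sum_congr rfl fun i _ => ?_
    rw [YoungDiagram.rowLen_eq_card]; rfl
  · rintro ⟨i, j⟩ hc
    have hc' := YoungDiagram.mem_iff_lt_rowLen.1 ((YoungDiagram.mem_cells _).1 hc)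
    by_contra hK
    have := lam.rowLen_anti K i (by simpa using hK)
    omega

theorem rowLen_eq_of_mem_iff {lam : YoungDiagram} {i r : ℕ} (h : ∀ j, (i, j) ∈ lam ↔ j < r) :
    lam.rowLen i = r := by
  simp only [YoungDiagram.mem_iff_lt_rowLen] at h
  exact eq_of_forall_lt_iff h

/-- The largest diagram inside `ν` whose `i`-th row has length at most `r i` for all `i`. -/
def truncate (ν : YoungDiagram) (r : ℕ → ℕ) : YoungDiagram where
  cells := ν.cells.filter fun c => ∀ i ≤ c.1, c.2 < r i
  isLowerSet := by
    rintro ⟨i, j⟩ ⟨i', j'⟩ h hc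
    simp only [Finset.coe_filter, YoungDiagram.mem_cells, Set.mem_ofPred_eq] at hc ⊢
    exact ⟨ν.up_left_mem h.1 h.2 hc.1, fun k hk => lt_of_le_of_lt h.2 (hc.2 k (hk.trans h.1))⟩

theorem rowLen_truncate {ν : YoungDiagram} {r : ℕ → ℕ} (hr : Antitone r)
    (hν : ∀ i, r i ≤ ν.rowLen i) (i : ℕ) : (truncate ν r).rowLen i = r i := by
  refine rowLen_eq_of_mem_iff fun j => ?_
  rw [← YoungDiagram.mem_cells]
  simp only [truncate, Finset.mem_filter, YoungDiagram.mem_cells, YoungDiagram.mem_iff_lt_rowLen]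
  exact ⟨fun h => h.2 i le_rfl, fun h => ⟨h.trans_le (hν i), fun k hk => h.trans_le (hr hk)⟩⟩

/-! ### The Bender–Knuth reflection -/

/-- The Bender–Knuth move in terms of row lengths: between `κ` and `ν`, the length `λ_i` ranges over
the interval from `max κ_i ν_{i+1}` to `min ν_i κ_{i-1}`, and each of these intervals is
reflected about its midpoint. -/
def benderKnuth (ν κ lam : YoungDiagram) : YoungDiagram :=
  truncate ν fun i => max (κ.rowLen i) (ν.rowLen (i + 1)) +
    (if i = 0 then ν.rowLen 0 else min (ν.rowLen i) (κ.rowLen (i - 1))) - lam.rowLen i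

theorem rowLen_benderKnuth {ν κ lam : YoungDiagram} (h₁ : IsStrip lam ν) (h₂ : IsStrip κ lam)
    (i : ℕ) : (benderKnuth ν κ lam).rowLen i = max (κ.rowLen i) (ν.rowLen (i + 1)) +
      (if i = 0 then ν.rowLen 0 else min (ν.rowLen i) (κ.rowLen (i - 1))) - lam.rowLen i := by
  rw [isStrip_iff_rowLen] at h₁ h₂
  refine rowLen_truncate (antitone_nat_of_succ_le fun i => ?_) (fun i => ?_) i
  · have a1 := h₁ i
    have a2 := h₂ i
    have a3 := h₁ (i + 1)
    have a4 := h₂ (i + 1)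
    rcases i with _ | i
    · simp only [Nat.add_sub_cancel]; grind
    · have a5 := h₂ i
      simp only [Nat.add_sub_cancel]; grind
  · have a1 := h₁ i
    have a2 := h₂ i
    rcases i with _ | i
    · grind
    · have a5 := h₂ i
      grind

theorem isStrip_benderKnuth {ν κ lam : YoungDiagram} (h₁ : IsStrip lam ν) (h₂ : IsStrip κ lam) :
    IsStrip (benderKnuth ν κ lam) ν := by
  have hb := rowLen_benderKnuth h₁ h₂
  rw [isStrip_iff_rowLen] at h₁ h₂ ⊢
  intro i
  have a1 := h₁ i
  have a2 := h₂ i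
  rw [hb]
  rcases i with _ | i
  · grind
  · have a5 := h₂ i
    grind

theorem isStrip_benderKnuth' {ν κ lam : YoungDiagram} (h₁ : IsStrip lam ν) (h₂ : IsStrip κ lam) :
    IsStrip κ (benderKnuth ν κ lam) := by
  have hb := rowLen_benderKnuth h₁ h₂
  rw [isStrip_iff_rowLen] at h₁ h₂ ⊢
  intro i
  have a1 := h₁ i
  have a2 := h₂ i
  have a3 := h₁ (i + 1)
  have a4 := h₂ (i + 1)
  rw [hb, hb]
  rcases i with _ | i
  · grind
  · have a5 := h₂ i
    grind

theorem benderKnuth_benderKnuth {ν κ lam : YoungDiagram} (h₁ : IsStrip lam ν)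
    (h₂ : IsStrip κ lam) : benderKnuth ν κ (benderKnuth ν κ lam) = lam := by
  have key : ∀ i, (benderKnuth ν κ (benderKnuth ν κ lam)).rowLen i = lam.rowLen i := by
    intro i
    rw [rowLen_benderKnuth (isStrip_benderKnuth h₁ h₂) (isStrip_benderKnuth' h₁ h₂),
      rowLen_benderKnuth h₁ h₂]
    rw [isStrip_iff_rowLen] at h₁ h₂
    have a1 := h₁ i
    have a2 := h₂ i
    rcases i with _ | i
    · grind
    · have a5 := h₂ i
      grind
  exact le_antisymm (le_iff_rowLen_le.2 fun i => (key i).le)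
    (le_iff_rowLen_le.2 fun i => (key i).ge)

/-- The identity `max κ_i ν_{i+1} + min ν_{i+1} κ_i = κ_i + ν_{i+1}`, summed over all rows. -/
theorem card_benderKnuth {ν κ lam : YoungDiagram} (h₁ : IsStrip lam ν) (h₂ : IsStrip κ lam) :
    (benderKnuth ν κ lam).card + lam.card = κ.card + ν.card := by
  have hb := rowLen_benderKnuth h₁ h₂
  obtain ⟨K, hK⟩ : ∃ K, ν.rowLen K = 0 := by
    obtain ⟨K, hK⟩ := ν.exists_notMem_col 0
    exact ⟨K, by simpa [YoungDiagram.mem_iff_lt_rowLen] using hK⟩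
  have hbν := isStrip_benderKnuth h₁ h₂
  rw [isStrip_iff_rowLen] at h₁ h₂ hbν
  have e1 := h₁ K
  have e2 := h₂ K
  have e3 := hbν K
  rw [card_eq_sum_rowLen (K := K) (by omega), card_eq_sum_rowLen (lam := lam) (K := K) (by omega),
    card_eq_sum_rowLen (lam := κ) (K := K) (by omega), card_eq_sum_rowLen hK]
  -- The partial sums differ by the part of the reflecting interval that belongs to the next row.
  have key : ∀ n, ∑ i ∈ Finset.range n, (benderKnuth ν κ lam).rowLen i +
      ∑ i ∈ Finset.range n, lam.rowLen i +
        (if n = 0 then ν.rowLen 0 else min (ν.rowLen n) (κ.rowLen (n - 1))) =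
      ∑ i ∈ Finset.range n, κ.rowLen i + ∑ i ∈ Finset.range n, ν.rowLen i + ν.rowLen n := by
    intro n
    induction n with
    | zero => simp
    | succ n ih =>
      simp only [Finset.sum_range_succ, Nat.add_sub_cancel]
      rw [hb n]
      have a1 := h₁ n
      have a2 := h₂ n
      rcases n with _ | n
      · simp only [Finset.range_zero, Finset.sum_empty, if_true, zero_add, one_ne_zero,
          if_false] at a1 a2 ⊢
        omega
      · have a5 := h₂ n
        simp only [Nat.add_sub_cancel, Nat.add_eq_zero_iff, one_ne_zero, and_false, if_false]
          at ih ⊢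
        omega
  have := key K
  rw [hK] at this
  split_ifs at this with h0
  · subst h0; simp_all
  · omega

/-! ### Schur sums and their symmetry -/

open scoped Classical in
/-- The Schur polynomial of `ν` at a list of ring elements, defined through the branching rule: the
cells that carry the letter of the head of the list form a horizontal strip. -/
def schurSum {R : Type*} [CommRing R] : YoungDiagram → List R → R
  | ν, [] => if ν = ⊥ then 1 else 0
  | ν, x :: xs => ∑ lam ∈ strips ν, schurSum lam xs * x ^ (ν.card - lam.card)

theorem IsStrip.card_le {lam ν : YoungDiagram} (h : IsStrip lam ν) : lam.card ≤ ν.card :=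
  Finset.card_le_card (YoungDiagram.cells_subset_iff.2 h.1)

theorem schurSum_swap {R : Type*} [CommRing R] (ν : YoungDiagram) (x y : R) (xs : List R) :
    schurSum ν (x :: y :: xs) = schurSum ν (y :: x :: xs) := by
  simp only [schurSum, Finset.sum_mul, Finset.sum_sigma']
  refine Finset.sum_nbij' (fun p => ⟨benderKnuth ν p.2 p.1, p.2⟩)
    (fun p => ⟨benderKnuth ν p.2 p.1, p.2⟩) ?_ ?_ ?_ ?_ ?_
  · rintro ⟨lam, κ⟩ h
    simp only [Finset.mem_sigma, mem_strips] at h ⊢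
    exact ⟨isStrip_benderKnuth h.1 h.2, isStrip_benderKnuth' h.1 h.2⟩
  · rintro ⟨lam, κ⟩ h
    simp only [Finset.mem_sigma, mem_strips] at h ⊢
    exact ⟨isStrip_benderKnuth h.1 h.2, isStrip_benderKnuth' h.1 h.2⟩
  · rintro ⟨lam, κ⟩ h
    simp only [Finset.mem_sigma, mem_strips] at h
    simp only [benderKnuth_benderKnuth h.1 h.2]
  · rintro ⟨lam, κ⟩ h
    simp only [Finset.mem_sigma, mem_strips] at h
    simp only [benderKnuth_benderKnuth h.1 h.2]
  · rintro ⟨lam, κ⟩ h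
    simp only [Finset.mem_sigma, mem_strips] at h
    have hc := card_benderKnuth h.1 h.2
    have h1 := h.1.card_le
    have h2 := h.2.card_le
    have e1 : ν.card - (benderKnuth ν κ lam).card = lam.card - κ.card := by omega
    have e2 : (benderKnuth ν κ lam).card - κ.card = ν.card - lam.card := by omega
    simp only [e1, e2]
    ring

theorem schurSum_perm {R : Type*} [CommRing R] {l l' : List R} (h : l.Perm l')
    (ν : YoungDiagram) : schurSum ν l = schurSum ν l' := by
  induction h generalizing ν with
  | nil => rfl
  | cons x _ ih => simp only [schurSum, ih]
  | swap x y l => exact schurSum_swap ν y x l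
  | trans _ _ ih₁ ih₂ => exact (ih₁ ν).trans (ih₂ ν)

theorem map_schurSum {R S : Type*} [CommRing R] [CommRing S] (f : R →+* S) (ν : YoungDiagram)
    (l : List R) : f (schurSum ν l) = schurSum ν (l.map f) := by
  induction l generalizing ν with
  | nil => simp [schurSum, apply_ite f]
  | cons x l ih => simp [schurSum, ih]

theorem schurSum_smul {R : Type*} [CommRing R] (t : R) (ν : YoungDiagram) (l : List R) :
    schurSum ν (l.map (t * ·)) = t ^ ν.card * schurSum ν l := by
  induction l generalizing ν with
  | nil =>
    by_cases h : ν = ⊥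
    · subst h; simp [schurSum, YoungDiagram.card]
    · simp [schurSum, h]
  | cons x l ih =>
    simp only [List.map_cons, schurSum, ih, Finset.mul_sum]
    refine Finset.sum_congr rfl fun lam h => ?_
    have := (mem_strips.1 h).card_le
    rw [← Nat.add_sub_cancel' this, pow_add, Nat.add_sub_cancel_left]
    ring

/-! ### The branching rule for tableaux -/

theorem SSYT.lt_of_mem {N : ℕ} {ν : YoungDiagram} (T : SSYT N ν) {i j : ℕ} (h : (i, j) ∈ ν) :
    T.1 i j < N :=
  T.2 ⟨(i, j), h⟩

/-- Evaluation of a Schur polynomial as a sum over tableaux. -/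
theorem aeval_schurPoly {R : Type*} [CommRing R] [Algebra ℤ R] (N : ℕ) (ν : YoungDiagram)
    (x : ℕ → R) :
    MvPolynomial.aeval (fun i : Fin N => x i) (schurPoly N ν) =
      ∑ T : SSYT N ν, ∏ c ∈ ν.cells, x (T.1 c.1 c.2) := by
  rw [schurPoly, map_sum]
  refine Finset.sum_congr rfl fun T _ => ?_
  rw [SSYT.weightMonomial, map_prod]
  simp only [SSYT.letter, MvPolynomial.aeval_X]
  exact Finset.prod_coe_sort ν.cells fun c => x (T.1 c.1 c.2)

/-- Filling a horizontal strip with the largest letter. -/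
def SSYT.extend {N : ℕ} {lam ν : YoungDiagram} (h : IsStrip lam ν) (T : SSYT N lam) :
    SSYT (N + 1) ν :=
  ⟨{  entry := fun i j => if (i, j) ∈ lam then T.1 i j else if (i, j) ∈ ν then N else 0
      row_weak' := by
        intro i j₁ j₂ hj h₂
        have hν := ν.up_left_mem le_rfl hj.le h₂
        by_cases hl : (i, j₂) ∈ lam
        · have hl₁ := lam.up_left_mem le_rfl hj.le hl
          simpa [hl, hl₁] using T.1.row_weak hj hl
        · by_cases hl₁ : (i, j₁) ∈ lam
          · simpa [hl, hl₁, h₂] using (T.lt_of_mem hl₁).le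
          · simp [hl, hl₁, h₂, hν]
      col_strict' := by
        intro i₁ i₂ j hi h₂
        have hl₁ : (i₁, j) ∈ lam := h.2 _ _ (ν.up_left_mem hi le_rfl h₂)
        by_cases hl : (i₂, j) ∈ lam
        · simpa [hl, hl₁] using T.1.col_strict hi hl
        · simpa [hl, hl₁, h₂] using T.lt_of_mem hl₁
      zeros' := by
        intro i j hν
        have : (i, j) ∉ lam := fun hl => hν (h.1 hl)
        simp [hν, this] }, by
    rintro ⟨⟨i, j⟩, hc⟩
    change (if (i, j) ∈ lam then T.1 i j else if (i, j) ∈ ν then N else 0) < N + 1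
    split_ifs with h₁ h₂
    · exact (T.lt_of_mem h₁).trans (Nat.lt_succ_self N)
    · exact Nat.lt_succ_self N
    · exact Nat.succ_pos N⟩

theorem SSYT.extend_apply {N : ℕ} {lam ν : YoungDiagram} (h : IsStrip lam ν) (T : SSYT N lam)
    (i j : ℕ) : (T.extend h).1 i j =
      if (i, j) ∈ lam then T.1 i j else if (i, j) ∈ ν then N else 0 :=
  rfl

/-- The cells of a tableau in the letters `0, …, N` whose entry is not `N`. -/
def SSYT.shape {N : ℕ} {ν : YoungDiagram} (T : SSYT (N + 1) ν) : YoungDiagram where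
  cells := ν.cells.filter fun c => T.1 c.1 c.2 < N
  isLowerSet := by
    rintro ⟨i, j⟩ ⟨i', j'⟩ h hc
    simp only [Finset.coe_filter, YoungDiagram.mem_cells, Set.mem_ofPred_eq] at hc ⊢
    have h' := ν.up_left_mem le_rfl h.2 hc.1
    exact ⟨ν.up_left_mem h.1 h.2 hc.1,
      ((T.1.col_weak h.1 h').trans (T.1.row_weak_of_le h.2 hc.1)).trans_lt hc.2⟩

theorem SSYT.mem_shape {N : ℕ} {ν : YoungDiagram} (T : SSYT (N + 1) ν) {i j : ℕ} :
    (i, j) ∈ T.shape ↔ (i, j) ∈ ν ∧ T.1 i j < N := by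
  rw [← YoungDiagram.mem_cells, shape, Finset.mem_filter, YoungDiagram.mem_cells]

theorem SSYT.isStrip_shape {N : ℕ} {ν : YoungDiagram} (T : SSYT (N + 1) ν) :
    IsStrip T.shape ν := by
  refine ⟨fun ⟨i, j⟩ h => (T.mem_shape.1 h).1, fun i j h => T.mem_shape.2
    ⟨ν.up_left_mem (Nat.le_succ i) le_rfl h, ?_⟩⟩
  have h1 := T.1.col_strict (Nat.lt_add_one i) h
  have h2 := T.lt_of_mem h
  omega

/-- The tableau left after deleting the cells with the largest letter. -/
def SSYT.restrict {N : ℕ} {ν : YoungDiagram} (T : SSYT (N + 1) ν) : SSYT N T.shape :=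
  ⟨{  entry := fun i j => if (i, j) ∈ T.shape then T.1 i j else 0
      row_weak' := by
        intro i j₁ j₂ hj h
        have h₁ := T.shape.up_left_mem le_rfl hj.le h
        simpa [h, h₁] using T.1.row_weak hj (T.isStrip_shape.1 h)
      col_strict' := by
        intro i₁ i₂ j hi h
        have h₁ := T.shape.up_left_mem hi.le le_rfl h
        simpa [h, h₁] using T.1.col_strict hi (T.isStrip_shape.1 h)
      zeros' := by
        intro i j h
        simp [h] }, by
    rintro ⟨⟨i, j⟩, hc⟩
    change (if (i, j) ∈ T.shape then T.1 i j else 0) < N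
    rw [YoungDiagram.mem_cells] at hc
    rw [if_pos hc]
    exact (T.mem_shape.1 hc).2⟩

theorem SSYT.extend_restrict {N : ℕ} {ν : YoungDiagram} (T : SSYT (N + 1) ν) :
    T.restrict.extend T.isStrip_shape = T := by
  refine Subtype.ext (SemistandardYoungTableau.ext fun i j => ?_)
  rw [extend_apply]
  have hr : T.restrict.1 i j = if (i, j) ∈ T.shape then T.1 i j else 0 := rfl
  rw [hr]
  split_ifs with h₁ h₂
  · rfl
  · have h3 := T.lt_of_mem h₂
    have h4 : ¬ T.1 i j < N := fun h => h₁ (T.mem_shape.2 ⟨h₂, h⟩)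
    omega
  · exact (T.1.zeros h₂).symm

theorem SSYT.shape_extend {N : ℕ} {lam ν : YoungDiagram} (h : IsStrip lam ν) (T : SSYT N lam) :
    (T.extend h).shape = lam := by
  refine SetLike.ext fun ⟨i, j⟩ => ?_
  rw [mem_shape, extend_apply]
  by_cases hl : (i, j) ∈ lam
  · simp [hl, h.1 hl, T.lt_of_mem hl]
  · by_cases hν : (i, j) ∈ ν <;> simp [hl, hν]

theorem SSYT.extend_injective {N : ℕ} {lam ν : YoungDiagram} (h : IsStrip lam ν) :
    Function.Injective (SSYT.extend (N := N) h) := by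
  intro S T hST
  refine Subtype.ext (SemistandardYoungTableau.ext fun i j => ?_)
  by_cases hl : (i, j) ∈ lam
  · have := congrArg (fun U : SSYT (N + 1) ν => U.1 i j) hST
    simpa [extend_apply, hl] using this
  · rw [S.1.zeros hl, T.1.zeros hl]

theorem SSYT.sum_succ {M : Type*} [AddCommMonoid M] {N : ℕ} {ν : YoungDiagram}
    (f : SSYT (N + 1) ν → M) :
    ∑ T, f T = ∑ lam : {lam // lam ∈ strips ν},
      ∑ T : SSYT N lam.1, f (T.extend (mem_strips.1 lam.2)) := by
  classical
  rw [← Finset.sum_fiberwise (g := fun T : SSYT (N + 1) ν =>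
    (⟨T.shape, mem_strips.2 T.isStrip_shape⟩ : {lam // lam ∈ strips ν}))]
  refine Finset.sum_congr rfl fun lam _ => ?_
  symm
  refine Finset.sum_bij (fun T _ => T.extend (mem_strips.1 lam.2)) ?_ ?_ ?_ fun _ _ => rfl
  · intro T _
    simp [shape_extend]
  · intro S _ T _ h
    exact extend_injective _ h
  · intro T hT
    simp only [Finset.mem_filter, Finset.mem_univ, true_and] at hT
    subst hT
    exact ⟨T.restrict, Finset.mem_univ _, T.extend_restrict⟩

theorem SSYT.prod_extend {R : Type*} [CommRing R] {N : ℕ} {lam ν : YoungDiagram}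
    (h : IsStrip lam ν) (T : SSYT N lam) (x : ℕ → R) :
    ∏ c ∈ ν.cells, x ((T.extend h).1 c.1 c.2) =
      (∏ c ∈ lam.cells, x (T.1 c.1 c.2)) * x N ^ (ν.card - lam.card) := by
  have hsub := YoungDiagram.cells_subset_iff.2 h.1
  rw [← Finset.prod_sdiff hsub, mul_comm]
  congr 1
  · refine Finset.prod_congr rfl fun c hc => ?_
    rw [extend_apply, if_pos ((YoungDiagram.mem_cells _).1 hc)]
  · rw [YoungDiagram.card, YoungDiagram.card, ← Finset.card_sdiff_of_subset hsub,
      ← Finset.prod_const]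
    refine Finset.prod_congr rfl fun c hc => ?_
    rw [Finset.mem_sdiff, YoungDiagram.mem_cells, YoungDiagram.mem_cells] at hc
    rw [extend_apply, if_neg hc.2, if_pos hc.1]

theorem sum_prod_eq_schurSum {R : Type*} [CommRing R] (N : ℕ) (ν : YoungDiagram) (x : ℕ → R) :
    ∑ T : SSYT N ν, ∏ c ∈ ν.cells, x (T.1 c.1 c.2) = schurSum ν ((List.range N).map x) := by
  induction N generalizing ν with
  | zero =>
    rw [List.range_zero, List.map_nil, schurSum]
    split_ifs with h
    · subst h
      have : Unique (SSYT 0 ⊥) :=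
        { default := ⟨SemistandardYoungTableau.highestWeight ⊥, fun c => by
            exact absurd ((YoungDiagram.mem_cells _).1 c.2) (YoungDiagram.notMem_bot _)⟩
          uniq := fun T => Subtype.ext (SemistandardYoungTableau.ext fun i j => by
            rw [T.1.zeros (YoungDiagram.notMem_bot _)]
            simp) }
      rw [Fintype.sum_unique]
      simp
    · have : IsEmpty (SSYT 0 ν) := by
        refine ⟨fun T => h (eq_bot_iff.2 ?_)⟩
        rintro ⟨i, j⟩ hc
        exact absurd (T.lt_of_mem hc) (Nat.not_lt_zero _)
      rw [Finset.univ_eq_empty, Finset.sum_empty]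
  | succ N ih =>
    have hp : ((List.range (N + 1)).map x).Perm (x N :: (List.range N).map x) := by
      rw [List.range_succ, List.map_append]
      exact List.perm_append_comm
    rw [schurSum_perm hp, schurSum, SSYT.sum_succ, ← Finset.sum_coe_sort (strips ν)]
    refine Finset.sum_congr rfl fun lam _ => ?_
    rw [← ih, Finset.sum_mul]
    exact Finset.sum_congr rfl fun T _ => SSYT.prod_extend _ T x

theorem aeval_schurPoly_eq_schurSum {R : Type*} [CommRing R] [Algebra ℤ R] {N : ℕ}
    (ν : YoungDiagram) (x : Fin N → R) :
    MvPolynomial.aeval x (schurPoly N ν) = schurSum ν (List.ofFn x) := by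
  obtain ⟨y, rfl⟩ : ∃ y : ℕ → R, x = fun i : Fin N => y i :=
    ⟨fun n => if h : n < N then x ⟨n, h⟩ else 0, by ext i; simp⟩
  rw [aeval_schurPoly, sum_prod_eq_schurSum]
  congr 1
  refine List.ext_getElem (by simp) fun i h₁ h₂ => by simp

/-! ### The characters of the symmetric powers -/

theorem mem_oneRow {h i j : ℕ} : (i, j) ∈ oneRow h ↔ i = 0 ∧ j < h := by
  refine YoungDiagram.mem_ofRowLens.trans ?_
  constructor
  · rintro ⟨h₁, h₂⟩
    simp only [List.length_singleton, Nat.lt_one_iff] at h₁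
    subst h₁
    exact ⟨rfl, h₂⟩
  · rintro ⟨rfl, h₂⟩
    exact ⟨by simp, h₂⟩

/-- The one-row tableau of length `h` in the letters `0, 1` that ends in `k` letters `1`. -/
def rowTableau (h : ℕ) (k : Fin (h + 1)) : SSYT 2 (oneRow h) :=
  ⟨{  entry := fun i j => if i = 0 ∧ j < h ∧ h - k ≤ j then 1 else 0
      row_weak' := by
        intro i j₁ j₂ hj hc
        rw [mem_oneRow] at hc
        grind
      col_strict' := by
        intro i₁ i₂ j hi hc
        rw [mem_oneRow] at hc
        omega
      zeros' := by
        intro i j hc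
        rw [mem_oneRow] at hc
        grind }, by
    rintro ⟨⟨i, j⟩, hc⟩
    change (if i = 0 ∧ j < h ∧ h - k ≤ j then 1 else 0) < 2
    split_ifs <;> omega⟩

theorem rowTableau_apply (h : ℕ) (k : Fin (h + 1)) (i j : ℕ) :
    (rowTableau h k).1 i j = if i = 0 ∧ j < h ∧ h - k ≤ j then 1 else 0 :=
  rfl

theorem rowTableau_bijective (h : ℕ) : Function.Bijective (rowTableau h) := by
  constructor
  · intro k l hkl
    have key : ∀ j, (rowTableau h k).1 0 j = (rowTableau h l).1 0 j := fun j => by rw [hkl]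
    have e1 := key (h - k)
    have e2 := key (h - l)
    simp only [rowTableau_apply] at e1 e2
    ext
    grind
  · intro T
    classical
    have hex : ∃ m, m = h ∨ T.1 0 m = 1 := ⟨h, Or.inl rfl⟩
    have hm : Nat.find hex ≤ h := Nat.find_min' hex (Or.inl rfl)
    refine ⟨⟨h - Nat.find hex, by omega⟩, Subtype.ext (SemistandardYoungTableau.ext fun i j => ?_)⟩
    rw [rowTableau_apply]
    by_cases hc : (i, j) ∈ oneRow h
    · obtain ⟨rfl, hj⟩ := mem_oneRow.1 hc
      have h2 := T.lt_of_mem hc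
      by_cases hle : Nat.find hex ≤ j
      · rw [if_pos ⟨rfl, hj, by simp; omega⟩]
        have h3 := (Nat.find_spec hex).resolve_left (by omega)
        have h4 := T.1.row_weak_of_le hle hc
        omega
      · rw [if_neg (by simp; omega)]
        have := Nat.find_min hex (not_le.1 hle)
        omega
    · rw [T.1.zeros hc, if_neg]
      rw [mem_oneRow] at hc
      tauto

theorem aeval_weightMonomial_rowTableau (h : ℕ) (k : Fin (h + 1)) :
    MvPolynomial.aeval ![LaurentPolynomial.T 1, LaurentPolynomial.T (-1)]
      (rowTableau h k).weightMonomial = (LaurentPolynomial.T ((h : ℤ) - 2 * k) : ℤ[T;T⁻¹]) := by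
  have hprod : ∀ g : ℕ × ℕ → ℤ[T;T⁻¹],
      ∏ c ∈ (oneRow h).cells, g c = ∏ j ∈ Finset.range h, g (0, j) := by
    intro g
    have hcells : (oneRow h).cells = {0} ×ˢ Finset.range h := by
      ext ⟨i, j⟩
      rw [YoungDiagram.mem_cells, mem_oneRow]
      simp [and_comm, eq_comm]
    rw [hcells, Finset.prod_product, Finset.prod_singleton]
  let x : ℕ → ℤ[T;T⁻¹] := fun i => if i = 0 then LaurentPolynomial.T 1 else LaurentPolynomial.T (-1)
  have hx : (![LaurentPolynomial.T 1, LaurentPolynomial.T (-1)] : Fin 2 → ℤ[T;T⁻¹]) =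
      fun i : Fin 2 => x i := by
    ext1 i; fin_cases i <;> simp [x]
  have h1 : MvPolynomial.aeval ![LaurentPolynomial.T 1, LaurentPolynomial.T (-1)]
      (rowTableau h k).weightMonomial = ∏ j ∈ Finset.range h, x ((rowTableau h k).1 0 j) := by
    rw [hx, SSYT.weightMonomial, map_prod]
    simp only [SSYT.letter, MvPolynomial.aeval_X]
    exact (Finset.prod_coe_sort (oneRow h).cells fun c => x ((rowTableau h k).1 c.1 c.2)).trans
      (hprod _)
  have hk : (k : ℕ) ≤ h := Nat.lt_succ_iff.1 k.2
  have h2 : ∀ j ∈ Finset.range (h - k), x ((rowTableau h k).1 0 j) = LaurentPolynomial.T 1 := by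
    intro j hj
    rw [Finset.mem_range] at hj
    rw [rowTableau_apply, if_neg (by omega)]
    rfl
  have h3 : ∀ j ∈ Finset.range k,
      x ((rowTableau h k).1 0 ((h - k) + j)) = LaurentPolynomial.T (-1) := by
    intro j hj
    rw [Finset.mem_range] at hj
    rw [rowTableau_apply, if_pos (by omega)]
    rfl
  have h4 : Finset.range h = Finset.range ((h - k) + k) := by rw [Nat.sub_add_cancel hk]
  rw [h1, h4, Finset.prod_range_add, Finset.prod_congr rfl h2, Finset.prod_congr rfl h3,
    Finset.prod_const, Finset.prod_const, Finset.card_range, Finset.card_range,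
    LaurentPolynomial.T_pow, LaurentPolynomial.T_pow, ← LaurentPolynomial.T_add]
  congr 1
  push_cast [hk]
  ring

/-- The weights of the `h`-th symmetric power of the natural representation of `SL₂`. -/
def symWeights (h : ℕ) : List ℤ[T;T⁻¹] :=
  (List.range (h + 1)).map fun k : ℕ => LaurentPolynomial.T ((h : ℤ) - 2 * k)

theorem sl2Plethysm_eq_schurSum (μ : YoungDiagram) (h : ℕ) :
    sl2Plethysm μ h = schurSum μ (symWeights h) := by
  rw [sl2Plethysm, plethysm, MvPolynomial.comp_aeval_apply, aeval_schurPoly_eq_schurSum]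
  apply schurSum_perm
  set w : SSYT 2 (oneRow h) → ℤ[T;T⁻¹] := fun T =>
    MvPolynomial.aeval ![LaurentPolynomial.T 1, LaurentPolynomial.T (-1)] T.weightMonomial with hw
  let e := (Equiv.ofBijective _ (rowTableau_bijective h)).trans (Fintype.equivFin _)
  -- Both lists enumerate the values of `w`, in two orders.
  have h1 : symWeights h = List.ofFn fun k : Fin (h + 1) => w (rowTableau h k) := by
    refine List.ext_getElem (by simp [symWeights]) fun i h₁ h₂ => ?_
    simp [symWeights, hw, aeval_weightMonomial_rowTableau, -List.ofFn_succ]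
  rw [h1, ← Multiset.coe_eq_coe, ← Fin.univ_val_map, ← Fin.univ_val_map,
    ← Multiset.map_univ_val_equiv e, Multiset.map_map]
  refine Multiset.map_congr rfl fun k _ => ?_
  simp [e, hw]

theorem invert_sl2Plethysm (μ : YoungDiagram) (h : ℕ) :
    LaurentPolynomial.invert (sl2Plethysm μ h) = sl2Plethysm μ h := by
  rw [sl2Plethysm_eq_schurSum]
  have := map_schurSum (LaurentPolynomial.invert (R := ℤ)).toRingEquiv.toRingHom μ (symWeights h)
  refine this.trans (schurSum_perm ?_ μ)
  have hr : (symWeights h).map (LaurentPolynomial.invert (R := ℤ)).toRingEquiv.toRingHom =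
      (symWeights h).reverse := by
    refine List.ext_getElem (by simp) fun i h₁ h₂ => ?_
    have hi : i ≤ h := by simpa [symWeights, Nat.lt_succ_iff] using h₂
    simp [symWeights, hi]
    ring_nf
  rw [hr]
  exact List.reverse_perm _

/-! ### Doubly infinite arrays and Elliott denominators -/

/-- Arrays of rational numbers, indexed by the exponent of `z` and the exponent of `q`. An array is
thought of as a formal series in `z^{±1}, q^{±1}`, possibly infinite in all directions. -/
abbrev Arr : Type := ℤ × ℤ → ℚ

/-- Multiplication of a formal series by the monomial with exponent `v`. -/
def mulMon (v : ℤ × ℤ) : Arr →ₗ[ℚ] Arr :=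
  LinearMap.funLeft ℚ ℚ fun x => x - v

@[simp]
theorem mulMon_apply (v : ℤ × ℤ) (f : Arr) (x : ℤ × ℤ) : mulMon v f x = f (x - v) :=
  rfl

/-- Multiplication by `1 - m`, where `m` is the monomial with exponent `v`. -/
def mulFactor (v : ℤ × ℤ) : Arr →ₗ[ℚ] Arr :=
  LinearMap.id - mulMon v

theorem mulFactor_eq (v : ℤ × ℤ) (f : Arr) : mulFactor v f = f - mulMon v f :=
  rfl

@[simp]
theorem mulFactor_apply (v : ℤ × ℤ) (f : Arr) (x : ℤ × ℤ) : mulFactor v f x = f x - f (x - v) :=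
  rfl

/-- Multiplication by the product of the factors `1 - m`, one for each exponent in the list. -/
def mulFactors : List (ℤ × ℤ) → Arr →ₗ[ℚ] Arr
  | [] => LinearMap.id
  | v :: l => mulFactor v ∘ₗ mulFactors l

@[simp]
theorem mulFactors_nil (f : Arr) : mulFactors [] f = f :=
  rfl

theorem mulFactors_cons (v : ℤ × ℤ) (l : List (ℤ × ℤ)) (f : Arr) :
    mulFactors (v :: l) f = mulFactor v (mulFactors l f) :=
  rfl

theorem mulMon_add (v w : ℤ × ℤ) (f : Arr) : mulMon (v + w) f = mulMon v (mulMon w f) := by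
  ext x; simp [sub_sub]

theorem mulMon_comm (v w : ℤ × ℤ) (f : Arr) : mulMon v (mulMon w f) = mulMon w (mulMon v f) := by
  rw [← mulMon_add, add_comm, mulMon_add]

theorem mulMon_mulFactor (v w : ℤ × ℤ) (f : Arr) :
    mulMon v (mulFactor w f) = mulFactor w (mulMon v f) := by
  rw [mulFactor_eq, mulFactor_eq, map_sub, mulMon_comm]

theorem mulMon_mulFactors (v : ℤ × ℤ) (l : List (ℤ × ℤ)) (f : Arr) :
    mulMon v (mulFactors l f) = mulFactors l (mulMon v f) := by
  induction l with
  | nil => rfl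
  | cons w l ih => rw [mulFactors_cons, mulFactors_cons, mulMon_mulFactor, ih]

theorem mulFactor_mulFactors (v : ℤ × ℤ) (l : List (ℤ × ℤ)) (f : Arr) :
    mulFactor v (mulFactors l f) = mulFactors l (mulFactor v f) := by
  rw [mulFactor_eq, mulFactor_eq, map_sub, mulMon_mulFactors]

theorem mulFactors_cons' (v : ℤ × ℤ) (l : List (ℤ × ℤ)) (f : Arr) :
    mulFactors (v :: l) f = mulFactors l (mulFactor v f) :=
  mulFactor_mulFactors v l f

theorem mulFactors_append (l l' : List (ℤ × ℤ)) (f : Arr) :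
    mulFactors (l ++ l') f = mulFactors l (mulFactors l' f) := by
  induction l with
  | nil => rfl
  | cons w l ih => rw [List.cons_append, mulFactors_cons, ih, mulFactors_cons]

theorem mulFactors_comm (l l' : List (ℤ × ℤ)) (f : Arr) :
    mulFactors l (mulFactors l' f) = mulFactors l' (mulFactors l f) := by
  induction l with
  | nil => rfl
  | cons w l ih => rw [mulFactors_cons, ih, mulFactors_cons, mulFactor_mulFactors]

theorem mulFactors_perm {l l' : List (ℤ × ℤ)} (h : l.Perm l') (f : Arr) :
    mulFactors l f = mulFactors l' f := by
  induction h with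
  | nil => rfl
  | cons v _ ih => rw [mulFactors_cons, ih, mulFactors_cons]
  | swap v w l => exact mulFactors_comm [w] [v] (mulFactors l f)
  | trans _ _ ih₁ ih₂ => exact ih₁.trans ih₂

/-- An array with finite support, that is, a Laurent polynomial in `z` and `q`. -/
def IsFin (f : Arr) : Prop :=
  (Function.support f).Finite

theorem IsFin.add {f g : Arr} (hf : IsFin f) (hg : IsFin g) : IsFin (f + g) :=
  (hf.union hg).subset (Function.support_add f g)

theorem IsFin.sub {f g : Arr} (hf : IsFin f) (hg : IsFin g) : IsFin (f - g) :=
  (hf.union hg).subset (Function.support_sub f g)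

theorem IsFin.mulMon {f : Arr} (hf : IsFin f) (v : ℤ × ℤ) : IsFin (mulMon v f) :=
  Set.Finite.preimage (sub_left_injective.injOn) hf

theorem IsFin.mulFactor {f : Arr} (hf : IsFin f) (v : ℤ × ℤ) : IsFin (mulFactor v f) :=
  hf.sub (hf.mulMon v)

theorem IsFin.mulFactors {f : Arr} (hf : IsFin f) (l : List (ℤ × ℤ)) : IsFin (mulFactors l f) := by
  induction l with
  | nil => exact hf
  | cons v l ih => exact ih.mulFactor v

/-- The series `f` is a Laurent polynomial divided by a product of factors `1 - m`, where the
exponents of the monomials `m` are taken from `s`. -/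
def HasDen (s : Set (ℤ × ℤ)) (f : Arr) : Prop :=
  ∃ l : List (ℤ × ℤ), (∀ v ∈ l, v ∈ s) ∧ IsFin (mulFactors l f)

theorem IsFin.hasDen {f : Arr} (hf : IsFin f) (s : Set (ℤ × ℤ)) : HasDen s f :=
  ⟨[], by simp, hf⟩

theorem HasDen.of_mulFactor {s : Set (ℤ × ℤ)} {f : Arr} {v : ℤ × ℤ} (hv : v ∈ s)
    (h : HasDen s (mulFactor v f)) : HasDen s f := by
  obtain ⟨l, hl, hf⟩ := h
  exact ⟨v :: l, by simpa [hv] using hl, by rwa [mulFactors_cons']⟩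

theorem HasDen.add {s : Set (ℤ × ℤ)} {f g : Arr} (hf : HasDen s f) (hg : HasDen s g) :
    HasDen s (f + g) := by
  obtain ⟨l, hl, hf⟩ := hf
  obtain ⟨l', hl', hg⟩ := hg
  refine ⟨l ++ l', fun v hv => (List.mem_append.1 hv).elim (hl v) (hl' v), ?_⟩
  rw [mulFactors_append, map_add, map_add, mulFactors_comm]
  exact (hf.mulFactors l').add (hg.mulFactors l)

theorem HasDen.neg {s : Set (ℤ × ℤ)} {f : Arr} (hf : HasDen s f) : HasDen s (-f) := by
  obtain ⟨l, hl, hf⟩ := hf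
  refine ⟨l, hl, ?_⟩
  rw [map_neg, IsFin, Function.support_neg]
  exact hf

theorem HasDen.sub {s : Set (ℤ × ℤ)} {f g : Arr} (hf : HasDen s f) (hg : HasDen s g) :
    HasDen s (f - g) := by
  rw [sub_eq_add_neg]
  exact hf.add hg.neg

theorem HasDen.mulMon {s : Set (ℤ × ℤ)} {f : Arr} (hf : HasDen s f) (v : ℤ × ℤ) :
    HasDen s (mulMon v f) := by
  obtain ⟨l, hl, hf⟩ := hf
  exact ⟨l, hl, by rw [← mulMon_mulFactors]; exact hf.mulMon v⟩

theorem HasDen.sum {ι : Type*} {s : Set (ℤ × ℤ)} (t : Finset ι) {f : ι → Arr}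
    (hf : ∀ i ∈ t, HasDen s (f i)) : HasDen s (∑ i ∈ t, f i) := by
  classical
  induction t using Finset.induction_on with
  | empty => exact IsFin.hasDen (by simp [IsFin]) s
  | insert i t hi ih =>
    rw [Finset.sum_insert hi]
    exact (hf i (Finset.mem_insert_self i t)).add
      (ih fun j hj => hf j (Finset.mem_insert_of_mem hj))

/-- `1 - m` divides `1 - m ^ k`. -/
theorem IsFin.mulFactor_nsmul {f : Arr} {v : ℤ × ℤ} (h : IsFin (SL2Plethysm.mulFactor v f))
    (k : ℕ) : IsFin (SL2Plethysm.mulFactor (k • v) f) := by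
  induction k with
  | zero =>
    have : SL2Plethysm.mulFactor (0 • v) f = 0 := by ext x; simp
    rw [this]
    simp [IsFin]
  | succ k ih =>
    have : SL2Plethysm.mulFactor ((k + 1) • v) f =
        SL2Plethysm.mulFactor v f + SL2Plethysm.mulMon v (SL2Plethysm.mulFactor (k • v) f) := by
      ext x
      simp only [succ_nsmul, mulFactor_apply, Pi.add_apply, mulMon_apply, sub_sub]
      rw [add_comm v]
      ring
    rw [this]
    exact h.add (ih.mulMon v)

theorem IsFin.mulFactors_nsmul {f : Arr} {l : List (ℤ × ℤ)} (k : ℤ × ℤ → ℕ)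
    (h : IsFin (SL2Plethysm.mulFactors l f)) :
    IsFin (SL2Plethysm.mulFactors (l.map fun v => k v • v) f) := by
  induction l generalizing f with
  | nil => exact h
  | cons v l ih =>
    rw [mulFactors_cons'] at h
    have := ih h
    rw [← mulFactor_mulFactors] at this
    exact this.mulFactor_nsmul (k v)

/-- The denominators can be enlarged so that all nonzero exponents of `q` in their factors have the
same absolute value `L`. -/
theorem HasDen.exists_uniform {f : Arr} (h : HasDen {v | v.1 = 1} f) :
    ∃ L : ℤ, 1 ≤ L ∧ ∃ l : List (ℤ × ℤ),
      (∀ v ∈ l, 1 ≤ v.1 ∧ (v.2 = 0 ∨ v.2 = L ∨ v.2 = -L)) ∧ IsFin (mulFactors l f) := by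
  obtain ⟨l, hl, hf⟩ := h
  set M : ℕ := (l.map fun v => max 1 v.2.natAbs).prod with hM
  have hM0 : 1 ≤ M := by
    refine Nat.one_le_iff_ne_zero.2 (List.prod_ne_zero ?_)
    rw [List.mem_map]
    rintro ⟨v, -, hv⟩
    omega
  refine ⟨M, by exact_mod_cast hM0, _, ?_,
    hf.mulFactors_nsmul fun v => if v.2 = 0 then 1 else M / v.2.natAbs⟩
  intro w hw
  obtain ⟨v, hv, rfl⟩ := List.mem_map.1 hw
  have hv1 : v.1 = 1 := hl v hv
  by_cases h0 : v.2 = 0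
  · simp [h0, hv1]
  · have hdvd : v.2.natAbs ∣ M := by
      have : max 1 v.2.natAbs ∣ M :=
        List.dvd_prod (List.mem_map_of_mem (f := fun v : ℤ × ℤ => max 1 v.2.natAbs) hv)
      rwa [max_eq_right (by omega)] at this
    have hpos : 1 ≤ M / v.2.natAbs := Nat.div_pos (Nat.le_of_dvd hM0 hdvd) (by omega)
    have hmul : ((M / v.2.natAbs : ℕ) : ℤ) * |v.2| = M := by
      rw [Int.abs_eq_natAbs]
      exact_mod_cast Nat.div_mul_cancel hdvd
    simp only [h0, if_false, Prod.smul_fst, Prod.smul_snd, hv1]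
    simp only [nsmul_eq_mul, mul_one]
    refine ⟨by exact_mod_cast hpos, Or.inr ?_⟩
    rcases abs_cases v.2 with ⟨ha, -⟩ | ⟨ha, -⟩ <;> rw [ha] at hmul
    · exact Or.inl hmul
    · right; rw [← hmul]; ring

/-! ### Elliott's elimination of negative exponents -/

/-- The part of a formal series with positive exponents of `q`. -/
def positivePart : Arr →ₗ[ℚ] Arr where
  toFun f x := if 1 ≤ x.2 then f x else 0
  map_add' f g := by ext x; simp only [Pi.add_apply]; split_ifs <;> simp
  map_smul' c f := by ext x; simp

theorem positivePart_apply (f : Arr) (x : ℤ × ℤ) : positivePart f x = if 1 ≤ x.2 then f x else 0 :=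
  rfl

theorem positivePart_mulFactor (a : ℤ) (f : Arr) :
    positivePart (mulFactor (a, 0) f) = mulFactor (a, 0) (positivePart f) := by
  ext x
  simp only [positivePart_apply, mulFactor_apply, Prod.snd_sub, sub_zero]
  split_ifs <;> simp

theorem mulFactor_apply_eq_zero {f : Arr} (h0 : ∀ x : ℤ × ℤ, x.1 < 0 → f x = 0) {v : ℤ × ℤ}
    (hv : 1 ≤ v.1) : ∀ x : ℤ × ℤ, x.1 < 0 → mulFactor v f x = 0 := by
  intro x hx
  rw [mulFactor_apply, h0 x hx, h0 (x - v) (by rw [Prod.fst_sub]; omega), sub_zero]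

/-- Dividing by `1 - m`, where `m` has positive degree with respect to `φ`, keeps the number of
terms of bounded degree finite. -/
theorem finite_of_mulFactor (φ : ℤ × ℤ →+ ℤ) {f : Arr} (h0 : ∀ x : ℤ × ℤ, x.1 < 0 → f x = 0)
    {v : ℤ × ℤ} (hv : 1 ≤ v.1) (hφ : 1 ≤ φ v)
    (hg : ∀ c : ℤ, {x | mulFactor v f x ≠ 0 ∧ φ x ≤ c}.Finite) (c : ℤ) :
    {x | f x ≠ 0 ∧ φ x ≤ c}.Finite := by
  have step : ∀ x, f x ≠ 0 → mulFactor v f x ≠ 0 ∨ f (x - v) ≠ 0 := by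
    intro x hx
    by_contra! h
    rw [mulFactor_apply, h.2, sub_zero] at h
    exact hx h.1
  obtain ⟨c₀, hc₀⟩ : ∃ c₀, ∀ x, φ x ≤ c₀ → mulFactor v f x = 0 := by
    obtain ⟨b, hb⟩ := ((hg 0).image φ).bddBelow
    refine ⟨min 0 (b - 1), fun x hx => ?_⟩
    by_contra hne
    have := hb ⟨x, ⟨hne, by omega⟩, rfl⟩
    omega
  have hlow : ∀ n : ℕ, ∀ x : ℤ × ℤ, x.1 < n → φ x ≤ c₀ → f x = 0 := by
    intro n
    induction n with
    | zero => intro x hx _; exact h0 x (by simpa using hx)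
    | succ n ih =>
      intro x hx hxc
      by_contra hne
      refine (step x hne).elim (fun h => h (hc₀ x hxc)) fun h => h (ih (x - v) ?_ ?_)
      · rw [Prod.fst_sub]; push_cast at hx; omega
      · rw [map_sub]; omega
  have hup : ∀ n : ℕ, {x | f x ≠ 0 ∧ φ x ≤ c₀ + n}.Finite := by
    intro n
    induction n with
    | zero =>
      refine Set.Finite.subset Set.finite_empty ?_
      rintro x ⟨hx, hxc⟩
      exact hx (hlow (x.1.toNat + 1) x (by push_cast; omega) (by simpa using hxc))
    | succ n ih =>
      refine ((hg (c₀ + (n + 1 : ℕ))).union (ih.image (· + v))).subset ?_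
      rintro x ⟨hx, hxc⟩
      refine (step x hx).imp (fun h => ⟨h, hxc⟩) fun h => ⟨x - v, ⟨h, ?_⟩, sub_add_cancel x v⟩
      rw [map_sub]; push_cast at hxc; omega
  refine (hup (c - c₀).toNat).subset ?_
  rintro x ⟨hx, hxc⟩
  exact ⟨hx, by omega⟩

theorem finite_of_mulFactors (φ : ℤ × ℤ →+ ℤ) {l : List (ℤ × ℤ)} {f : Arr}
    (h0 : ∀ x : ℤ × ℤ, x.1 < 0 → f x = 0) (hl : ∀ v ∈ l, 1 ≤ v.1 ∧ 1 ≤ φ v)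
    (hg : IsFin (mulFactors l f)) (c : ℤ) : {x | f x ≠ 0 ∧ φ x ≤ c}.Finite := by
  induction l generalizing f c with
  | nil => exact Set.Finite.subset hg fun x hx => hx.1
  | cons v l ih =>
    have hv := hl v List.mem_cons_self
    rw [mulFactors_cons'] at hg
    exact finite_of_mulFactor φ h0 hv.1 hv.2 (fun c => ih (mulFactor_apply_eq_zero h0 hv.1)
      (fun w hw => hl w (List.mem_cons_of_mem v hw)) hg c) c

/-- The part with positive exponents of `q` inherits a denominator. A factor without `q` commutes
with taking the positive part; two factors `1 - A` and `1 - B` with opposite exponents of `q` are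
eliminated by `1 - AB = (1 - A) + (1 - B) - (1 - A) (1 - B)`; if all exponents of `q` have
the same sign, then either the positive or the nonpositive part is finite. -/
theorem hasDen_positivePart_of_uniform {L : ℤ} (hL : 1 ≤ L) (n : ℕ) {l : List (ℤ × ℤ)}
    (hn : l.length ≤ n) {f : Arr} (h0 : ∀ x : ℤ × ℤ, x.1 < 0 → f x = 0)
    (hl : ∀ v ∈ l, 1 ≤ v.1 ∧ (v.2 = 0 ∨ v.2 = L ∨ v.2 = -L)) (hf : IsFin (mulFactors l f)) :
    HasDen {v | 1 ≤ v.1 ∧ 0 ≤ v.2} (positivePart f) := by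
  induction n generalizing l f with
  | zero =>
    obtain rfl := List.eq_nil_of_length_eq_zero (Nat.le_zero.1 hn)
    refine IsFin.hasDen (Set.Finite.subset hf fun x hx => ?_) _
    rw [Function.mem_support, positivePart_apply] at hx
    exact (ite_ne_right_iff.1 hx).2
  | succ n ih =>
    by_cases hz : ∃ v ∈ l, v.2 = 0
    · obtain ⟨⟨a, b⟩, hv, hb⟩ := hz
      obtain rfl : b = 0 := hb
      have ha := (hl _ hv).1
      have hp := List.perm_cons_erase hv
      rw [mulFactors_perm hp, mulFactors_cons'] at hf
      refine HasDen.of_mulFactor (v := (a, 0)) ⟨ha, le_rfl⟩ ?_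
      rw [← positivePart_mulFactor]
      refine ih ?_ (mulFactor_apply_eq_zero h0 ha) (fun w hw => hl w (List.mem_of_mem_erase hw)) hf
      have := hp.length_eq
      rw [List.length_cons] at this
      omega
    by_cases hplus : ∃ v ∈ l, v.2 = L
    · by_cases hminus : ∃ w ∈ l, w.2 = -L
      · obtain ⟨v, hv, hv2⟩ := hplus
        obtain ⟨w, hw, hw2⟩ := hminus
        have hvw : w ≠ v := by rintro rfl; omega
        have hp : l.Perm (v :: w :: (l.erase v).erase w) :=
          (List.perm_cons_erase hv).trans
            ((List.perm_cons_erase ((List.mem_erase_of_ne hvw).2 hw)).cons v)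
        set l' := (l.erase v).erase w
        have hlen := hp.length_eq
        simp only [List.length_cons] at hlen
        have hl' : ∀ u ∈ l', u ∈ l := fun u hu => List.mem_of_mem_erase (List.mem_of_mem_erase hu)
        have hv1 := (hl v hv).1
        have hw1 := (hl w hw).1
        have hsum : v + w = (v.1 + w.1, 0) := by ext <;> simp [hv2, hw2]
        have key : mulFactor (v.1 + w.1, 0) f =
            mulFactor v f + mulFactor w f - mulFactor v (mulFactor w f) := by
          rw [← hsum]
          ext x
          simp only [mulFactor_apply, Pi.add_apply, Pi.sub_apply, sub_sub]
          ring
        rw [mulFactors_perm hp] at hf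
        refine HasDen.of_mulFactor (v := (v.1 + w.1, 0)) ⟨by simp only; omega, le_rfl⟩ ?_
        rw [← positivePart_mulFactor, key, map_sub, map_add]
        have hl₁ : ∀ u ∈ w :: l', u ∈ l := by
          rintro u hu
          rcases List.mem_cons.1 hu with rfl | hu
          exacts [hw, hl' u hu]
        have hl₂ : ∀ u ∈ v :: l', u ∈ l := by
          rintro u hu
          rcases List.mem_cons.1 hu with rfl | hu
          exacts [hv, hl' u hu]
        refine ((ih (l := w :: l') ?_ (mulFactor_apply_eq_zero h0 hv1)
          (fun u hu => hl u (hl₁ u hu)) ?_).add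
          (ih (l := v :: l') ?_ (mulFactor_apply_eq_zero h0 hw1)
          (fun u hu => hl u (hl₂ u hu)) ?_)).sub
          (ih (l := l') ?_ (mulFactor_apply_eq_zero (mulFactor_apply_eq_zero h0 hw1) hv1)
          (fun u hu => hl u (hl' u hu)) ?_)
        · simp only [List.length_cons]; omega
        · rwa [← mulFactors_cons']
        · simp only [List.length_cons]; omega
        · rwa [← mulFactors_cons', mulFactors_perm (List.Perm.swap v w l')]
        · omega
        · rwa [← mulFactors_cons', ← mulFactors_cons', mulFactors_perm (List.Perm.swap v w l')]
      · have hl' : ∀ v ∈ l, v.2 = L := fun v hv => by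
          rcases (hl v hv).2 with h | h | h
          exacts [absurd ⟨v, hv, h⟩ hz, h, absurd ⟨v, hv, h⟩ hminus]
        have hfin := finite_of_mulFactors (AddMonoidHom.snd ℤ ℤ) h0
          (fun v hv => ⟨(hl v hv).1, by simpa [hl' v hv] using hL⟩) hf 0
        have hneg : IsFin (f - positivePart f) := by
          refine hfin.subset fun x hx => ?_
          simp only [Function.mem_support, Pi.sub_apply, positivePart_apply] at hx
          split_ifs at hx with h
          · simp at hx
          · exact ⟨by simpa using hx, Int.lt_add_one_iff.1 (not_le.1 h)⟩
        refine ⟨l, fun v hv => ⟨(hl v hv).1, by rw [hl' v hv]; omega⟩, ?_⟩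
        rw [← sub_sub_cancel f (positivePart f), map_sub]
        exact hf.sub (hneg.mulFactors l)
    · have hl' : ∀ v ∈ l, v.2 = -L := fun v hv => by
        rcases (hl v hv).2 with h | h | h
        exacts [absurd ⟨v, hv, h⟩ hz, absurd ⟨v, hv, h⟩ hplus, h]
      have hfin := finite_of_mulFactors (-AddMonoidHom.snd ℤ ℤ) h0
        (fun v hv => ⟨(hl v hv).1, by simpa [hl' v hv] using hL⟩) hf (-1)
      refine IsFin.hasDen (hfin.subset fun x hx => ?_) _
      simp only [Function.mem_support, positivePart_apply] at hx
      obtain ⟨h, hx⟩ := ite_ne_right_iff.1 hx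
      exact ⟨hx, by simpa using h⟩

theorem HasDen.positivePart {f : Arr} (h0 : ∀ x : ℤ × ℤ, x.1 < 0 → f x = 0)
    (h : HasDen {v | v.1 = 1} f) : HasDen {v | 1 ≤ v.1 ∧ 0 ≤ v.2} (positivePart f) := by
  obtain ⟨L, hL, l, hl, hf⟩ := h.exists_uniform
  exact hasDen_positivePart_of_uniform hL l.length le_rfl h0 hl hf

/-! ### The transfer recursion for the characters -/

open LaurentPolynomial in
/-- Up to a power of `q`, the Schur polynomial of `ν` at the weights `q^h, q^{h-2}, …, q^{-h}`. The
power is chosen so that the recursion in `h` has coefficients that do not depend on `h`; it is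
trivial for `m = |ν|`. -/
def transfer (m : ℤ) (ν : YoungDiagram) (h : ℕ) : ℤ[T;T⁻¹] :=
  T (h * (2 * ν.card - m)) * schurSum ν ((List.range (h + 1)).map fun k : ℕ => T (-2 * (k : ℤ)))

open LaurentPolynomial in
theorem transfer_card (μ : YoungDiagram) (h : ℕ) : transfer μ.card μ h = sl2Plethysm μ h := by
  have hl : symWeights h =
      ((List.range (h + 1)).map fun k : ℕ => (T (-2 * (k : ℤ)) : ℤ[T;T⁻¹])).map (T h * ·) := by
    rw [symWeights, List.map_map]
    refine List.map_congr_left fun k _ => ?_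
    rw [Function.comp_apply, ← T_add]
    congr 1
  have he : (h : ℤ) * (2 * μ.card - μ.card) = μ.card * h := by ring
  rw [sl2Plethysm_eq_schurSum, hl, schurSum_smul, T_pow, transfer, he]

open LaurentPolynomial in
theorem transfer_succ (m : ℤ) (ν : YoungDiagram) (h : ℕ) :
    transfer m ν (h + 1) =
      ∑ lam ∈ strips ν, T (2 * lam.card - m) * transfer m lam h := by
  have hp : ((List.range (h + 1 + 1)).map fun k : ℕ => (T (-2 * (k : ℤ)) : ℤ[T;T⁻¹])).Perm
      (T (-2 * ((h + 1 : ℕ) : ℤ)) ::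
        (List.range (h + 1)).map fun k : ℕ => (T (-2 * (k : ℤ)) : ℤ[T;T⁻¹])) := by
    rw [List.range_succ, List.map_append]
    exact List.perm_append_comm
  rw [transfer, schurSum_perm hp, schurSum, Finset.mul_sum]
  refine Finset.sum_congr rfl fun lam hlam => ?_
  have hc := (mem_strips.1 hlam).card_le
  rw [transfer, T_pow, mul_comm (schurSum lam _), ← mul_assoc, ← T_add,
    ← mul_assoc (T (2 * _ - m)) (T _), ← T_add]
  congr 2
  push_cast [hc]
  ring

/-- The array of coefficients of the series `∑ p_h z^h`. -/
def arr (p : ℕ → ℤ[T;T⁻¹]) : Arr :=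
  fun x => if 0 ≤ x.1 then ((p x.1.toNat).coeff x.2 : ℚ) else 0

theorem arr_of_neg (p : ℕ → ℤ[T;T⁻¹]) (x : ℤ × ℤ) (hx : x.1 < 0) : arr p x = 0 :=
  if_neg (not_le.2 hx)

theorem arr_natCast (p : ℕ → ℤ[T;T⁻¹]) (h : ℕ) (n : ℤ) : arr p (h, n) = (p h).coeff n := by
  simp [arr]

theorem coeff_T_mul (n : ℤ) (f : ℤ[T;T⁻¹]) (k : ℤ) :
    (LaurentPolynomial.T n * f).coeff k = f.coeff (k - n) := by
  rw [LaurentPolynomial.T, AddMonoidAlgebra.coeff_single_mul_apply, one_mul, neg_add_eq_sub]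

/-- A linear recursion in `h`, translated to arrays. -/
theorem arr_eq_of_succ {ι : Type*} (t : Finset ι) (e : ι → ℤ) (p : ℕ → ℤ[T;T⁻¹])
    (p' : ι → ℕ → ℤ[T;T⁻¹])
    (hp : ∀ h, p (h + 1) = ∑ i ∈ t, LaurentPolynomial.T (e i) * p' i h) :
    arr p = arr (fun h => if h = 0 then p 0 else 0) + ∑ i ∈ t, mulMon (1, e i) (arr (p' i)) := by
  ext ⟨h, n⟩
  rw [Pi.add_apply, Finset.sum_apply]
  simp only [mulMon_apply, Prod.mk_sub_mk]
  rcases lt_or_ge h 0 with hh | hh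
  · rw [arr_of_neg _ _ hh, arr_of_neg _ _ hh, Finset.sum_eq_zero, add_zero]
    intro i _
    exact arr_of_neg _ _ (by simp only; omega)
  · lift h to ℕ using hh
    rcases h with _ | h
    · rw [arr_natCast, arr_natCast, Finset.sum_eq_zero]
      · simp
      · intro i _
        exact arr_of_neg _ _ (by simp)
    · have : ((h + 1 : ℕ) : ℤ) - 1 = h := by push_cast; ring
      rw [this, arr_natCast, arr_natCast, hp]
      simp only [arr_natCast]
      simp [coeff_T_mul, -LaurentPolynomial.T_mul]

theorem isFin_arr_single (p : ℤ[T;T⁻¹]) : IsFin (arr fun h => if h = 0 then p else 0) := by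
  refine ((p.coeff.support.finite_toSet).image fun n => ((0 : ℤ), n)).subset ?_
  rintro ⟨h, n⟩ hx
  simp only [Function.mem_support, arr] at hx
  obtain ⟨h0, hx⟩ := ite_ne_right_iff.1 hx
  split_ifs at hx with h1
  · refine ⟨n, by simpa using hx, ?_⟩
    simp only [Prod.mk.injEq, and_true]
    omega
  · simp at hx

/-- The recursion is triangular for inclusion of diagrams, with the factors `1 - z q ^ (2|λ| - m)`
on the diagonal. -/
theorem hasDen_transfer (m : ℤ) (ν : YoungDiagram) :
    HasDen {v | v.1 = 1} (arr (transfer m ν)) := by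
  classical
  induction hn : ν.card using Nat.strong_induction_on generalizing ν with
  | _ n ih =>
    subst hn
    have hν : ν ∈ strips ν :=
      mem_strips.2 ⟨le_rfl, fun i j h => ν.up_left_mem (Nat.le_succ i) le_rfl h⟩
    have h := arr_eq_of_succ (strips ν) (fun lam => 2 * lam.card - m) (transfer m ν)
      (fun lam => transfer m lam) (transfer_succ m ν)
    rw [← Finset.add_sum_erase _ _ hν, add_left_comm, ← sub_eq_iff_eq_add'] at h
    refine HasDen.of_mulFactor (v := (1, 2 * ν.card - m)) rfl ?_
    rw [mulFactor_eq, h]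
    refine ((isFin_arr_single _).hasDen _).add (HasDen.sum _ fun lam hlam => ?_)
    rw [Finset.mem_erase, mem_strips] at hlam
    refine (ih lam.card (Finset.card_lt_card (YoungDiagram.cells_ssubset_iff.2
      (lt_of_le_of_ne hlam.2.1 hlam.1))) lam rfl).mulMon _

/-! ### The coefficients -/

/-- The character `s_μ[s_h](q, q⁻¹)`, multiplied by `q - q⁻¹`. -/
def skewPlethysm (μ : YoungDiagram) (h : ℕ) : ℤ[T;T⁻¹] :=
  sl2Plethysm μ h * (LaurentPolynomial.T 1 - LaurentPolynomial.T (-1))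

theorem coeff_skewPlethysm (μ : YoungDiagram) (h : ℕ) (n : ℤ) :
    (skewPlethysm μ h).coeff n =
      (sl2Plethysm μ h).coeff (n - 1) - (sl2Plethysm μ h).coeff (n + 1) := by
  rw [skewPlethysm, mul_comm, sub_mul, AddMonoidAlgebra.coeff_sub, Finsupp.sub_apply,
    coeff_T_mul, coeff_T_mul, sub_neg_eq_add]

theorem coeff_skewPlethysm_neg (μ : YoungDiagram) (h : ℕ) (n : ℤ) :
    (skewPlethysm μ h).coeff (-n) = -(skewPlethysm μ h).coeff n := by
  have hs : ∀ k, (sl2Plethysm μ h).coeff (-k) = (sl2Plethysm μ h).coeff k := fun k => by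
    conv_rhs => rw [← invert_sl2Plethysm, LaurentPolynomial.invert_apply]
  rw [coeff_skewPlethysm, coeff_skewPlethysm, ← hs (n - 1), ← hs (n + 1)]
  ring_nf

theorem hasDen_skewPlethysm (μ : YoungDiagram) : HasDen {v | v.1 = 1} (arr (skewPlethysm μ)) := by
  have h := hasDen_transfer μ.card μ
  have heq : arr (skewPlethysm μ) = mulMon (0, 1) (arr (transfer μ.card μ)) -
      mulMon (0, -1) (arr (transfer μ.card μ)) := by
    ext ⟨h, n⟩
    simp only [arr, Pi.sub_apply, mulMon_apply, Prod.mk_sub_mk, sub_zero, transfer_card,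
      coeff_skewPlethysm, sub_neg_eq_add]
    split_ifs <;> simp
  rw [heq]
  exact (h.mulMon _).sub (h.mulMon _)

/-- The coefficient of `[k]_q` in a combination of `q`-integers is the coefficient of `q ^ k` after
multiplication by `q - q⁻¹`. -/
theorem coeff_sum_T_sub_T (c : ℕ →₀ ℤ) (hc : c 0 = 0) (n : ℕ) :
    (c.sum fun k r => r • (LaurentPolynomial.T (k : ℤ) - LaurentPolynomial.T (-(k : ℤ)) :
      ℤ[T;T⁻¹])).coeff n = c n := by
  rw [Finsupp.sum, AddMonoidAlgebra.coeff_sum, Finsupp.finsetSum_apply]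
  have key : ∀ k ∈ c.support, (c k • (LaurentPolynomial.T (k : ℤ) - LaurentPolynomial.T (-(k : ℤ)) :
      ℤ[T;T⁻¹])).coeff n = if k = n then c k else 0 := by
    intro k hk
    have hk0 : k ≠ 0 := by rintro rfl; exact Finsupp.mem_support_iff.1 hk hc
    have hkn : -(k : ℤ) ≠ n := by omega
    rw [AddMonoidAlgebra.coeff_smul, Finsupp.smul_apply, AddMonoidAlgebra.coeff_sub,
      Finsupp.sub_apply, LaurentPolynomial.T_apply, LaurentPolynomial.T_apply, if_neg hkn]
    simp
  rw [Finset.sum_congr rfl key, Finset.sum_ite_eq']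
  simp [eq_comm]

theorem sum_qInt_mul (c : ℕ →₀ ℤ) :
    (c.sum fun k r => r • qInt k) * (LaurentPolynomial.T 1 - LaurentPolynomial.T (-1)) =
      c.sum fun k r => r • (LaurentPolynomial.T (k : ℤ) - LaurentPolynomial.T (-(k : ℤ)) :
        ℤ[T;T⁻¹]) := by
  simp only [Finsupp.sum, Finset.sum_mul, smul_mul_assoc, qInt_mul]

/-- The coefficients of the positive powers of `q` in `(q - q⁻¹) s_μ[s_h](q, q⁻¹)`. -/
def plethysmCoeff (μ : YoungDiagram) (h : ℕ) : ℕ →₀ ℤ :=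
  (skewPlethysm μ h).coeff.comapDomain (fun k : ℕ => (k : ℤ)) Nat.cast_injective.injOn

theorem plethysmCoeff_apply (μ : YoungDiagram) (h k : ℕ) :
    plethysmCoeff μ h k = (skewPlethysm μ h).coeff k :=
  rfl

theorem plethysmCoeff_zero (μ : YoungDiagram) (h : ℕ) : plethysmCoeff μ h 0 = 0 := by
  have := coeff_skewPlethysm_neg μ h 0
  rw [neg_zero] at this
  rw [plethysmCoeff_apply, Nat.cast_zero]
  omega

theorem IsPlethysmCoeff.eq_plethysmCoeff {μ : YoungDiagram} {b : ℕ → ℕ →₀ ℤ}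
    (hb : IsPlethysmCoeff μ b) : b = plethysmCoeff μ := by
  ext h k
  rw [plethysmCoeff_apply, skewPlethysm, (hb h).2, sum_qInt_mul, coeff_sum_T_sub_T _ (hb h).1]

theorem isPlethysmCoeff_plethysmCoeff (μ : YoungDiagram) :
    IsPlethysmCoeff μ (plethysmCoeff μ) := by
  refine fun h => ⟨plethysmCoeff_zero μ h, ?_⟩
  have hne : (LaurentPolynomial.T 1 - LaurentPolynomial.T (-1) : ℤ[T;T⁻¹]) ≠ 0 := by
    intro h0
    have := congrArg (fun p : ℤ[T;T⁻¹] => p.coeff 1) h0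
    simp at this
  refine mul_right_cancel₀ hne ?_
  rw [sum_qInt_mul]
  change skewPlethysm μ h = _
  set E := (plethysmCoeff μ h).sum fun k r =>
    r • (LaurentPolynomial.T (k : ℤ) - LaurentPolynomial.T (-(k : ℤ)) : ℤ[T;T⁻¹]) with hE
  have hpos : ∀ n : ℕ, E.coeff n = (skewPlethysm μ h).coeff n := fun n => by
    rw [hE, coeff_sum_T_sub_T _ (plethysmCoeff_zero μ h), plethysmCoeff_apply]
  -- Both sides are odd under the exchange of `q` and `q⁻¹`.
  have hodd : LaurentPolynomial.invert E = -E := by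
    rw [hE, Finsupp.sum, map_sum, ← Finset.sum_neg_distrib]
    refine Finset.sum_congr rfl fun k _ => ?_
    rw [map_zsmul, map_sub, LaurentPolynomial.invert_T, LaurentPolynomial.invert_T, neg_neg,
      ← smul_neg, neg_sub]
  refine LaurentPolynomial.ext fun n => ?_
  obtain ⟨k, rfl | rfl⟩ := n.eq_nat_or_neg
  · exact (hpos k).symm
  · rw [coeff_skewPlethysm_neg, ← hpos, ← LaurentPolynomial.invert_apply, hodd,
      AddMonoidAlgebra.coeff_neg, Finsupp.neg_apply]

/-! ### From arrays to rational functions and recurrences -/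

/-- The power series with the coefficients of an array in the quadrant of natural exponents. -/
def toSeries (f : Arr) : MvPowerSeries (Fin 2) ℚ :=
  fun m => f (m 0, m 1)

theorem coeff_toSeries (f : Arr) (m : Fin 2 →₀ ℕ) :
    MvPowerSeries.coeff m (toSeries f) = f (m 0, m 1) :=
  rfl

/-- The array vanishes outside the quadrant of natural exponents. -/
def IsNatSupported (f : Arr) : Prop :=
  ∀ x : ℤ × ℤ, x.1 < 0 ∨ x.2 < 0 → f x = 0

/-- The exponent `(v.1, v.2)` of a monomial in `z` and `q`. -/
def expo (v : ℤ × ℤ) : Fin 2 →₀ ℕ :=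
  Finsupp.equivFunOnFinite.symm ![v.1.toNat, v.2.toNat]

/-- The polynomial `1 - m`, where `m` is the monomial with exponent `v`. -/
def factor (v : ℤ × ℤ) : MvPolynomial (Fin 2) ℚ :=
  1 - MvPolynomial.monomial (expo v) 1

theorem coe_factor (v : ℤ × ℤ) : (factor v : MvPowerSeries (Fin 2) ℚ) =
    1 - MvPowerSeries.monomial (expo v) 1 := by
  rw [factor, ← MvPolynomial.coeToMvPowerSeries.ringHom_apply, map_sub, map_one,
    MvPolynomial.coeToMvPowerSeries.ringHom_apply, MvPolynomial.coe_monomial]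

theorem IsNatSupported.mulFactor {f : Arr} (hf : IsNatSupported f) {v : ℤ × ℤ}
    (hv : 1 ≤ v.1 ∧ 0 ≤ v.2) : IsNatSupported (mulFactor v f) := by
  intro x hx
  rw [mulFactor_apply, hf x hx, hf (x - v) (by rw [Prod.fst_sub, Prod.snd_sub]; omega), sub_zero]

theorem toSeries_mulFactor {f : Arr} (hf : IsNatSupported f) {v : ℤ × ℤ}
    (hv : 1 ≤ v.1 ∧ 0 ≤ v.2) :
    toSeries (mulFactor v f) = (factor v : MvPowerSeries (Fin 2) ℚ) * toSeries f := by
  classical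
  ext m
  obtain ⟨a, b⟩ := v
  obtain ⟨ha, hb⟩ : 1 ≤ a ∧ 0 ≤ b := hv
  lift a to ℕ using by omega
  lift b to ℕ using hb
  have hle : expo (a, b) ≤ m ↔ a ≤ m 0 ∧ b ≤ m 1 := by
    rw [Finsupp.le_def, Fin.forall_fin_two]
    simp [expo]
  rw [coe_factor, sub_mul, one_mul, map_sub, MvPowerSeries.coeff_monomial_mul]
  simp only [coeff_toSeries, mulFactor_apply, hle, Prod.mk_sub_mk, one_mul]
  congr 1
  split_ifs with h
  · simp [expo, Nat.cast_sub h.1, Nat.cast_sub h.2]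
  · exact hf _ (by simp only; omega)

theorem toSeries_mulFactors {f : Arr} (hf : IsNatSupported f) {l : List (ℤ × ℤ)}
    (hl : ∀ v ∈ l, 1 ≤ v.1 ∧ 0 ≤ v.2) :
    toSeries (mulFactors l f) =
      (((l.map factor).prod : MvPolynomial (Fin 2) ℚ) : MvPowerSeries (Fin 2) ℚ) * toSeries f := by
  induction l generalizing f with
  | nil => simp
  | cons v l ih =>
    have hv := hl v List.mem_cons_self
    rw [mulFactors_cons', ih (hf.mulFactor hv) fun w hw => hl w (List.mem_cons_of_mem v hw),
      toSeries_mulFactor hf hv, List.map_cons, List.prod_cons, MvPolynomial.coe_mul]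
    ring

theorem IsFin.exists_toSeries_eq {f : Arr} (hf : IsFin f) :
    ∃ p : MvPolynomial (Fin 2) ℚ, (p : MvPowerSeries (Fin 2) ℚ) = toSeries f := by
  classical
  have hfin : {m : Fin 2 →₀ ℕ | f (m 0, m 1) ≠ 0}.Finite := by
    refine Set.Finite.preimage (f := fun m : Fin 2 →₀ ℕ => ((m 0 : ℤ), (m 1 : ℤ))) ?_ hf
    intro m _ m' _ h
    simp only [Prod.mk.injEq, Nat.cast_inj] at h
    ext i; fin_cases i
    exacts [h.1, h.2]
  refine ⟨∑ m ∈ hfin.toFinset, MvPolynomial.monomial m (f (m 0, m 1)), ?_⟩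
  ext m
  rw [MvPolynomial.coeff_coe, MvPolynomial.coeff_sum, coeff_toSeries]
  simp only [MvPolynomial.coeff_monomial, Finset.sum_ite_eq', Set.Finite.mem_toFinset]
  by_cases h : f (m 0, m 1) = 0 <;> simp [h]

theorem factor_ne_zero {v : ℤ × ℤ} (hv : 1 ≤ v.1) : factor v ≠ 0 := by
  classical
  intro h
  have h0 : expo v ≠ 0 := fun h0 => by
    have := DFunLike.congr_fun h0 0
    simp [expo] at this
    omega
  have := congrArg (MvPolynomial.coeff 0) h
  simp [factor, MvPolynomial.coeff_monomial, h0] at this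

theorem exists_isElliottRational {f : Arr} (hf : IsNatSupported f)
    (h : HasDen {v | 1 ≤ v.1 ∧ 0 ≤ v.2} f) :
    ∃ r : FractionRing (MvPolynomial (Fin 2) ℚ),
      IsElliottRational r ∧ IsExpansion (toSeries f) r := by
  obtain ⟨l, hl, hfin⟩ := h
  obtain ⟨p, hp⟩ := hfin.exists_toSeries_eq
  refine ⟨_, ⟨p, (l.map factor : List _), ?_, rfl⟩, p, (l.map factor).prod, ?_, by simp, ?_⟩
  · intro d hd
    obtain ⟨v, hv, rfl⟩ := List.mem_map.1 (Multiset.mem_coe.1 hd)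
    exact ⟨factor_ne_zero (hl v hv).1, 1, _, Or.inr ⟨0, rfl⟩, Or.inr ⟨_, rfl⟩, rfl⟩
  · refine List.prod_ne_zero fun h0 => ?_
    obtain ⟨v, hv, h0⟩ := List.mem_map.1 h0
    exact factor_ne_zero (hl v hv).1 h0
  · rw [hp, toSeries_mulFactors hf hl]

/-- Expansion of a product of factors `1 - m` as `1` minus a combination of nontrivial monomials. -/
theorem exists_mulFactors_apply_eq {l : List (ℤ × ℤ)} (hl : ∀ v ∈ l, 1 ≤ v.1 ∧ 0 ≤ v.2) :
    ∃ c : ℕ × ℕ →₀ ℚ, c (0, 0) = 0 ∧ ∀ (f : Arr) (x : ℤ × ℤ),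
      mulFactors l f x = f x - c.sum fun s r => r * f (x - ((s.1 : ℤ), (s.2 : ℤ))) := by
  induction l with
  | nil => exact ⟨0, rfl, fun f x => by simp⟩
  | cons v l ih =>
    obtain ⟨c, hc, h⟩ := ih fun w hw => hl w (List.mem_cons_of_mem v hw)
    obtain ⟨a, b⟩ := v
    obtain ⟨ha, hb⟩ : 1 ≤ a ∧ 0 ≤ b := hl _ List.mem_cons_self
    lift a to ℕ using by omega
    lift b to ℕ using hb
    have ha' : 1 ≤ a := by exact_mod_cast ha
    refine ⟨c + Finsupp.single (a, b) 1 - c.mapDomain ((a, b) + ·), ?_, fun f x => ?_⟩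
    · rw [Finsupp.sub_apply, Finsupp.add_apply, hc, Finsupp.single_eq_of_ne,
        Finsupp.mapDomain_of_notMem_range]
      · simp
      · rintro ⟨s, hs⟩
        have := congrArg Prod.fst hs
        simp at this
        omega
      · simp only [ne_eq, Prod.mk.injEq]
        omega
    · rw [mulFactors_cons, mulFactor_apply, h, h, Finsupp.sum_sub_index, Finsupp.sum_add_index',
        Finsupp.sum_single_index, Finsupp.sum_mapDomain_index]
      · simp only [sub_sub, Prod.mk_add_mk, Prod.fst_add, Prod.snd_add, Nat.cast_add, one_mul]
        ring
      all_goals intros; ring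

theorem satisfiesLinearRecurrence_of_hasDen {f : Arr} (hf : IsNatSupported f)
    (h : HasDen {v | 1 ≤ v.1 ∧ 0 ≤ v.2} f) :
    SatisfiesLinearRecurrence fun h k : ℕ => f (h, k) := by
  obtain ⟨l, hl, hfin⟩ := h
  obtain ⟨c, hc, h⟩ := exists_mulFactors_apply_eq hl
  refine ⟨c, hc, ?_⟩
  have hinj : Set.InjOn (fun x : ℕ × ℕ => ((x.1 : ℤ), (x.2 : ℤ)))
      ((fun x : ℕ × ℕ => ((x.1 : ℤ), (x.2 : ℤ))) ⁻¹' Function.support (mulFactors l f)) := by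
    rintro ⟨a, b⟩ _ ⟨a', b'⟩ _ hx
    simpa using hx
  refine (Set.Finite.preimage hinj hfin).subset ?_
  rintro ⟨i, j⟩ hx
  rw [Set.mem_preimage, Function.mem_support, h, sub_ne_zero]
  refine fun heq => hx (heq.trans (Finsupp.sum_congr fun s _ => ?_))
  split_ifs with hs
  · simp only [Prod.mk_sub_mk, Nat.cast_sub hs.1, Nat.cast_sub hs.2]
  · rw [hf _ (by simp only [Prod.mk_sub_mk]; simp only at hs; omega)]

end SL2Plethysm

end

theorem mainTheorem4 (μ : YoungDiagram) :
    ∃ a : ℕ → ℕ →₀ ℤ,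
      SL2Plethysm.IsPlethysmCoeff μ a ∧
      (∀ b : ℕ → ℕ →₀ ℤ, SL2Plethysm.IsPlethysmCoeff μ b → b = a) ∧
      (∃ f : FractionRing (MvPolynomial (Fin 2) ℚ),
        SL2Plethysm.IsElliottRational f ∧
        SL2Plethysm.IsExpansion (SL2Plethysm.genSeries a) f) ∧
      SL2Plethysm.SatisfiesLinearRecurrence (fun h k => (a h k : ℚ)) := by
  open SL2Plethysm in
  have hden := HasDen.positivePart (arr_of_neg _) (hasDen_skewPlethysm μ)
  have hsupp : IsNatSupported (positivePart (arr (skewPlethysm μ))) := by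
    rintro ⟨h, n⟩ hx
    rw [positivePart_apply]
    rcases hx with hx | hx
    · rw [arr_of_neg _ _ hx, ite_self]
    · exact if_neg (by simp only at hx ⊢; omega)
  have hval : ∀ h k : ℕ, positivePart (arr (skewPlethysm μ)) (h, k) =
      (plethysmCoeff μ h k : ℚ) := by
    intro h k
    rw [positivePart_apply, arr_natCast, plethysmCoeff_apply]
    split_ifs with hk
    · rfl
    · obtain rfl : k = 0 := by simp only at hk; omega
      rw [← plethysmCoeff_apply, plethysmCoeff_zero, Int.cast_zero]
  have hser : genSeries (plethysmCoeff μ) = toSeries (positivePart (arr (skewPlethysm μ))) := by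
    funext m
    rw [genSeries, toSeries, hval]
    split_ifs with hk
    · rfl
    · rw [show m 1 = 0 by omega, plethysmCoeff_zero, Int.cast_zero]
  refine ⟨plethysmCoeff μ, isPlethysmCoeff_plethysmCoeff μ, fun b hb => hb.eq_plethysmCoeff, ?_, ?_⟩
  · rw [hser]
    exact exists_isElliottRational hsupp hden
  · simpa only [hval] using satisfiesLinearRecurrence_of_hasDen hsupp hden
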